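/- Let $R=\mathbb{C}[x_0,x_1,x_2]$ with its standard grading, let $f\in R_d$ be a square-free homogeneous polynomial of degree $d$, write $\partial_i f=\partial f/\partial x_i$, let $J_f=(\partial_0 f,\partial_1 f,\partial_2 f)$ be the Jacobian ideal and $I_f$ its saturation with respect to $(x_0,x_1,x_2)$. Let ${\rm Syz}(J_f)=\{(a_0,a_1,a_2)\in R^3 : a_0\partial_0 f+a_1\partial_1 f+a_2\partial_2 f=0\}$ and let ${\rm mdr}(f)$ be the least degree $n$ with ${\rm Syz}(J_f)_n\neq 0$. Suppose that the reduced curve $C=V(f)\subset\mathbb{P}^2$ is nearly free, i.e. $N(f)=I_f/J_f\neq 0$ and $\dim_{\mathbb C}N(f)_s\le 1$ for all $s\in\mathbb{Z}$. Assume that there are $b,c\in\mathbb{C}$, both non-zero, such that $(0,bx_1,cx_2)\in{\rm Syz}(J_f)$. Then $r:={\rm mdr}(f)=1$ and $d\ge 2r=2$; one can write $\partial_0 f=g\,x_1+\omega$ with $g\in R_{d-2}$ and a non-zero $\omega\in\mathbb{C}[x_0]_{d-1}$; and for every $g\in R_{d-2}$ and $\omega\in\mathbb{C}[x_0]_{d-1}$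 with $\partial_0 f=g\,x_1+\omega$, the matrices $$M_f=\begin{pmatrix}0&-\partial_1 f&-\partial_2 f\\ bx_1&\omega&0\\ cx_2&-\frac{c}{b}\,g\,x_2&\partial_0 f\end{pmatrix},\qquad P_f=\begin{pmatrix}\omega\\-bx_1\\-cx_2\end{pmatrix}$$ are a first and a second syzygy matrix in the minimal graded free resolution of $J_f$, that is, $$0\longrightarrow R(-d+r-1)\overset{P_f}{\longrightarrow}R(-r)\oplus R(-d+r)^2\overset{M_f}{\longrightarrow}R^3\overset{(\partial_0 f,\,\partial_1 f,\,\partial_2 f)}{\longrightarrow}J_f(d-1)\longrightarrow 0$$ is exact, its maps are graded of degree $0$, and all entries of $M_f$ and $P_f$ lie in $(x_0,x_1,x_2)$. -/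

import Mathlib

open MvPolynomial

namespace PlaneCurve

/-- The polynomial ring `R = ℂ[x₀, x₁, x₂]`. -/
abbrev R : Type := MvPolynomial (Fin 3) ℂ

/-- The homogeneous part `R_s`, for `s : ℤ`; it is zero when `s < 0`. -/
noncomputable def gradedPart (s : ℤ) : Submodule ℂ R :=
  if 0 ≤ s then homogeneousSubmodule (Fin 3) ℂ s.toNat else ⊥

/-- The irrelevant maximal ideal `(x₀, x₁, x₂)`. -/
noncomputable abbrev irrelevantIdeal : Ideal R := idealOfVars (Fin 3) ℂ

/-- The gradient `(∂₀f, ∂₁f, ∂₂f)`. -/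
noncomputable def grad (f : R) : Fin 3 → R := fun i => pderiv i f

/-- The Jacobian ideal `J_f`. -/
noncomputable def jacobianIdeal (f : R) : Ideal R :=
  Ideal.span (Set.range (grad f))

/-- The saturation of `I` with respect to the irrelevant ideal, that is
`{h | 𝔪 ^ k * h ⊆ I for some k}`. -/
noncomputable def saturation (I : Ideal R) : Ideal R where
  carrier := {h | ∃ k : ℕ, ∀ p ∈ irrelevantIdeal ^ k, p * h ∈ I}
  zero_mem' := ⟨0, fun p _ => by simp⟩
  add_mem' := by
    rintro a b ⟨k, hk⟩ ⟨l, hl⟩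
    refine ⟨k + l, fun p hp => ?_⟩
    rw [mul_add]
    exact I.add_mem (hk p (Ideal.pow_le_pow_right (Nat.le_add_right k l) hp))
      (hl p (Ideal.pow_le_pow_right (Nat.le_add_left l k) hp))
  smul_mem' := by
    rintro c a ⟨k, hk⟩
    refine ⟨k, fun p hp => ?_⟩
    rw [smul_eq_mul, mul_left_comm]
    exact I.mul_mem_left c (hk p hp)

/-- The degree `s` part `I ∩ R_s` of a homogeneous ideal `I`. -/
noncomputable def idealPart (I : Ideal R) (s : ℤ) : Submodule ℂ R :=
  I.restrictScalars ℂ ⊓ gradedPart s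

/-- The degree `s` part `N(f)_s = (I_f)_s / (J_f)_s` of `N(f) = I_f / J_f`, where `I_f` is the
saturation of `J_f`. -/
abbrev NPart (f : R) (s : ℤ) : Type :=
  (idealPart (saturation (jacobianIdeal f)) s) ⧸
    (idealPart (jacobianIdeal f) s).submoduleOf (idealPart (saturation (jacobianIdeal f)) s)

/-- `V(f)` is nearly free: `N(f) = I_f / J_f` is nonzero, and `dim N(f)_s ≤ 1` for every `s`. -/
def NearlyFree (f : R) : Prop :=
  saturation (jacobianIdeal f) ≠ jacobianIdeal f ∧ ∀ s : ℤ, Module.rank ℂ (NPart f s) ≤ 1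

/-- The module `Syz(J_f)` of all Jacobian relations for `f`. -/
noncomputable def syz (f : R) : Submodule R (Fin 3 → R) :=
  LinearMap.ker (Fintype.linearCombination R (grad f))

/-- The minimal degree of a nontrivial Jacobian syzygy, `mdr(f) = min {n | Syz(J_f)_n ≠ 0}`. -/
noncomputable def mdr (f : R) : ℕ :=
  sInf {n | ∃ v ∈ syz f, v ≠ 0 ∧ ∀ i, (v i).IsHomogeneous n}

/-- The sequence
`0 → ⨁ₖ R(-a₂ k) --P--> ⨁ⱼ R(-a₁ j) --M--> ⨁ᵢ R(-a₀ i) --φ--> I(e) → 0`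
is a minimal graded free resolution of the twisted ideal `I(e)`. -/
structure IsMinimalFreeResolution {n₀ n₁ n₂ : ℕ} (I : Ideal R) (e : ℤ)
    (a₀ : Fin n₀ → ℤ) (a₁ : Fin n₁ → ℤ) (a₂ : Fin n₂ → ℤ) (φ : Fin n₀ → R)
    (M : Matrix (Fin n₀) (Fin n₁) R) (P : Matrix (Fin n₁) (Fin n₂) R) : Prop where
  /-- The three maps are graded of degree `0`. -/
  graded_gens : ∀ i, φ i ∈ gradedPart (e + a₀ i)
  graded_first : ∀ i j, M i j ∈ gradedPart (a₁ j - a₀ i)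
  graded_second : ∀ j k, P j k ∈ gradedPart (a₂ k - a₁ j)
  /-- The sequence is exact. -/
  range_gens : LinearMap.range (Fintype.linearCombination R φ) = I
  exact_first : Function.Exact M.mulVecLin (Fintype.linearCombination R φ)
  exact_second : Function.Exact P.mulVecLin M.mulVecLin
  injective_second : Function.Injective P.mulVecLin
  /-- The resolution is minimal. -/
  minimal_first : ∀ i j, M i j ∈ irrelevantIdeal
  minimal_second : ∀ j k, P j k ∈ irrelevantIdeal

/-- `M` and `P` are a first and a second syzygy matrix in a minimal free resolution
`0 → R(-d+r-1) → R(-r) ⊕ R(-d+r)² → R³ → J_f(d-1) → 0`, the last map being the gradient. -/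
def AreSyzygyMatrices (f : R) (d r : ℕ)
    (M : Matrix (Fin 3) (Fin 3) R) (P : Matrix (Fin 3) (Fin 1) R) : Prop :=
  IsMinimalFreeResolution (jacobianIdeal f) ((d : ℤ) - 1)
    ![0, 0, 0] ![(r : ℤ), (d : ℤ) - r, (d : ℤ) - r] ![(d : ℤ) - r + 1] (grad f) M P

/-- `∂₀f = g x₁ + ω` with `g ∈ R_{d-2}` and `ω ∈ ℂ[x₀]_{d-1}`. -/
def IsDecomposition (f : R) (d : ℕ) (g ω : R) : Prop :=
  g ∈ gradedPart ((d : ℤ) - 2) ∧ ω ∈ gradedPart ((d : ℤ) - 1) ∧ ω ∈ supported ℂ ({0} : Set (Fin 3)) ∧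
    pderiv 0 f = g * X 1 + ω

/-- The matrix `M_f`. -/
noncomputable def firstSyzygyMatrix (f : R) (b c : ℂ) (g ω : R) : Matrix (Fin 3) (Fin 3) R :=
  !![0,           -pderiv 1 f,              -pderiv 2 f;
     C b * X 1,   ω,                        0;
     C c * X 2,   -(C (c / b) * g * X 2),   pderiv 0 f]

/-- The matrix `P_f`. -/
noncomputable def secondSyzygyMatrix (b c : ℂ) (ω : R) : Matrix (Fin 3) (Fin 1) R :=
  !![ω; -(C b * X 1); -(C c * X 2)]

end PlaneCurve

/-! Write `fᵢ` for `∂ᵢf`. The relation `b x₁ f₁ + c x₂ f₂ = 0` forces `f₁ = x₂ h` and `f₂ = -(b/c)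
x₁ h`, so `J_f = (f₀) + h (x₁, x₂)`. Since `f` is square-free, `h` and `f₀` are coprime
(`isRelPrime_of_pderiv_eq`). The relation also says that every monomial `m` of `f` satisfies `b m₁ +
c m₂ = 0`, so `x₁` and `x₂` occur in it together or not at all.

Near freeness enters through `N(f) ≠ 0`: this excludes `d ≤ 1`, and it forces `x₀ ^ d` to occur in
`f` (`coeff_single_zero_ne_zero`), since otherwise `x₁ x₂` divides `f₀` and `J_f` is saturated.
Hence `f₀ ∉ (x₁, x₂)`.

Now a syzygy `v` has `v₀ = h e` by coprimality. Then `f₀ e ∈ (x₁, x₂)`, and primality gives `e ∈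
(x₁, x₂)`. What remains is a Koszul relation between `x₁` and `x₂`, and the columns of `M_f`
generate (`exists_of_mem_syz`). The relations among the columns are the multiples of `P_f` because
`x₁ ∤ ω`. -/

namespace MvPolynomial

/-! ### Ideals generated by variables -/

theorem isPrime_span_X_image {σ K : Type*} [CommRing K] [IsDomain K] (s : Set σ) :
    (Ideal.span (X '' s : Set (MvPolynomial σ K))).IsPrime := by
  classical
  let φ : MvPolynomial σ K →ₐ[K] MvPolynomial σ K := aeval fun i => if i ∈ s then 0 else X i
  have hker : Ideal.span (X '' s) = RingHom.ker φ := by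
    apply le_antisymm
    · rw [Ideal.span_le]
      rintro _ ⟨i, hi, rfl⟩
      simp [φ, RingHom.mem_ker, hi]
    · intro p hp
      -- Killing the variables in `s` changes nothing modulo the ideal they generate.
      have h : (Ideal.Quotient.mkₐ K (Ideal.span (X '' s : Set (MvPolynomial σ K)))).comp φ =
          Ideal.Quotient.mkₐ K (Ideal.span (X '' s : Set (MvPolynomial σ K))) := by
        ext i
        by_cases hi : i ∈ s
        · have : (X i : MvPolynomial σ K) ∈ Ideal.span (X '' s : Set (MvPolynomial σ K)) :=
            Ideal.subset_span ⟨i, hi, rfl⟩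
          simpa [φ, hi] using (Ideal.Quotient.eq_zero_iff_mem.mpr this).symm
        · simp [φ, hi]
      have h' := DFunLike.congr_fun h p
      rw [RingHom.mem_ker] at hp
      rw [AlgHom.comp_apply, hp, map_zero] at h'
      exact Ideal.Quotient.eq_zero_iff_mem.mp h'.symm
  rw [hker]
  exact RingHom.ker_isPrime _

theorem isPrime_span_X_pair {σ K : Type*} [CommRing K] [IsDomain K] (i j : σ) :
    (Ideal.span {X i, X j} : Ideal (MvPolynomial σ K)).IsPrime := by
  simpa [Set.image_pair] using isPrime_span_X_image (K := K) ({i, j} : Set σ)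

theorem X_notMem_span_X_pair {σ K : Type*} [CommRing K] [Nontrivial K] {i j k : σ} (hi : k ≠ i)
    (hj : k ≠ j) : (X k : MvPolynomial σ K) ∉ Ideal.span {X i, X j} := by
  classical
  intro h
  rw [← Set.image_pair, mem_ideal_span_X_image] at h
  obtain ⟨l, hl, hne⟩ := h (Finsupp.single k 1) (by simp [support_X])
  rcases hl with rfl | rfl <;> simp [*] at hne

/-! ### Partial derivatives, multiple factors and complete intersections -/

theorem totalDegree_pderiv_lt {σ K : Type*} [CommSemiring K] {i : σ} {p : MvPolynomial σ K}
    (h : pderiv i p ≠ 0) : (pderiv i p).totalDegree < p.totalDegree := by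
  have key : ∀ m ∈ (pderiv i p).support, m.degree < p.totalDegree := by
    intro m hm
    rw [mem_support_iff, coeff_pderiv] at hm
    have h1 := le_totalDegree (mem_support_iff.mpr (left_ne_zero_of_mul hm))
    have h2 : (m + Finsupp.single i 1).degree ≤ p.totalDegree := h1
    rw [map_add, Finsupp.degree_single] at h2
    omega
  obtain ⟨m, hm⟩ := support_nonempty.mpr h
  exact (Finset.sup_lt_iff (lt_of_le_of_lt (Nat.zero_le _) (key m hm))).mpr key

theorem pderiv_eq_zero_of_dvd {σ K : Type*} [CommRing K] [IsDomain K] {i : σ}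
    {p : MvPolynomial σ K} (h : p ∣ pderiv i p) : pderiv i p = 0 := by
  by_contra h0
  obtain ⟨q, hq⟩ := h
  have hlt := totalDegree_pderiv_lt h0
  rw [hq] at h0 hlt
  rw [totalDegree_mul_of_isDomain (left_ne_zero_of_mul h0) (right_ne_zero_of_mul h0)] at hlt
  omega

theorem exists_pderiv_ne_zero {σ K : Type*} [Field K] [CharZero K] {p : MvPolynomial σ K}
    (h0 : p ≠ 0) (hu : ¬ IsUnit p) : ∃ i, pderiv i p ≠ 0 := by
  by_contra! h
  have hC : p = C (coeff 0 p) := by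
    classical
    ext m
    rw [coeff_C]
    split_ifs with hm
    · rw [hm]
    · obtain ⟨i, hi⟩ := Finsupp.ne_iff.mp (Ne.symm hm)
      have := congrArg (coeff (m - Finsupp.single i 1)) (h i)
      rw [coeff_pderiv, coeff_zero, mul_eq_zero] at this
      have hle : Finsupp.single i 1 ≤ m := by
        rw [Finsupp.single_le_iff]
        exact Nat.one_le_iff_ne_zero.mpr hi
      rw [tsub_add_cancel_of_le hle] at this
      exact this.resolve_right (Nat.cast_add_one_ne_zero _)
  apply hu
  rw [hC]
  refine IsUnit.map C (isUnit_iff_ne_zero.mpr fun h1 => h0 ?_)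
  rw [hC, h1, C_0]

/-- The operator `xᵢ ∂ᵢ` is diagonal in the monomial basis, so a diagonal linear syzygy becomes a
linear condition on exponents. -/
theorem coeff_X_mul_pderiv {σ K : Type*} [CommSemiring K] (i : σ) (p : MvPolynomial σ K)
    (m : σ →₀ ℕ) : coeff m (X i * pderiv i p) = m i * coeff m p := by
  classical
  induction p using MvPolynomial.induction_on' with
  | add p q hp hq => simp [hp, hq, mul_add]
  | monomial n a =>
    rw [X_mul_pderiv_monomial, coeff_smul, coeff_monomial]
    split_ifs with h
    · simp [h]
    · simp

/-- A common prime factor of all the partial derivatives of a homogeneous polynomial of positive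
degree is a multiple factor. -/
theorem sq_dvd_of_dvd_pderiv {σ K : Type*} [Fintype σ] [Field K] [CharZero K]
    {f q : MvPolynomial σ K} {d : ℕ} (hf : f.IsHomogeneous d) (hd : d ≠ 0) (hq : Irreducible q)
    (h : ∀ i, q ∣ pderiv i f) : q * q ∣ f := by
  have hqf : q ∣ f := by
    have h1 : q ∣ d • f := by
      rw [← hf.sum_X_mul_pderiv]
      exact Finset.dvd_sum fun i _ => (h i).mul_left _
    have h2 : f = C (d : K)⁻¹ * (d • f) := by
      rw [nsmul_eq_mul, ← mul_assoc, ← C_eq_coe_nat, ← C_mul,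
        inv_mul_cancel₀ (Nat.cast_ne_zero.mpr hd), C_1, one_mul]
    rw [h2]
    exact h1.mul_left _
  obtain ⟨k, rfl⟩ := hqf
  obtain ⟨i, hi⟩ := exists_pderiv_ne_zero hq.ne_zero hq.not_isUnit
  have h3 := h i
  rw [pderiv_mul, dvd_add_left (dvd_mul_right _ _)] at h3
  rcases hq.prime.dvd_or_dvd h3 with h4 | h4
  · exact absurd (pderiv_eq_zero_of_dvd h4) hi
  · exact mul_dvd_mul_left q h4

/-- In three variables, the ideal of a complete intersection of codimension two is saturated. -/
theorem mem_span_pair_of_X_mul_mem {K : Type*} [Field K] {A B : MvPolynomial (Fin 3) K}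
    (hAB : IsRelPrime A B) {u : MvPolynomial (Fin 3) K}
    (hu : ∀ i : Fin 3, X i * u ∈ Ideal.span {A, B}) : u ∈ Ideal.span {A, B} := by
  by_cases hB : B = 0
  · subst hB
    have : IsUnit A := hAB (dvd_refl _) (dvd_zero _)
    rw [Ideal.eq_top_of_isUnit_mem _ (Ideal.subset_span (Set.mem_insert A {0})) this]
    trivial
  simp only [Ideal.mem_span_pair] at hu ⊢
  choose a b hab using hu
  -- Two expressions of `xᵢ xⱼ u` in terms of `A, B` differ by a multiple of the Koszul relation.
  have ht : ∀ i j, ∃ t, X j * a i - X i * a j = B * t ∧ X j * b i - X i * b j = -(A * t) := by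
    intro i j
    have h1 : A * (X j * a i - X i * a j) = B * (-(X j * b i - X i * b j)) := by
      linear_combination X j * hab i - X i * hab j
    obtain ⟨t, ht⟩ := hAB.symm.dvd_of_dvd_mul_left ⟨_, h1⟩
    refine ⟨t, ht, mul_left_cancel₀ hB ?_⟩
    rw [ht] at h1
    linear_combination h1
  obtain ⟨t01, h01, k01⟩ := ht 0 1
  obtain ⟨t02, h02, -⟩ := ht 0 2
  obtain ⟨t12, h12, -⟩ := ht 1 2
  have hrel : X 2 * t01 - X 1 * t02 + X 0 * t12 = 0 := by
    apply mul_left_cancel₀ hB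
    linear_combination -X 2 * h01 + X 1 * h02 - X 0 * h12
  have hmem : X 2 * t01 ∈ Ideal.span {X 0, X 1} :=
    Ideal.mem_span_pair.mpr ⟨-t12, t02, by linear_combination -hrel⟩
  obtain ⟨α, β, hαβ⟩ := Ideal.mem_span_pair.mp
    (((isPrime_span_X_pair 0 1).mem_or_mem hmem).resolve_left
      (X_notMem_span_X_pair (by decide) (by decide)))
  have X_dvd : ∀ {i j : Fin 3} {p q : MvPolynomial (Fin 3) K},
      j ≠ i → X j * p = X i * q → X i ∣ p :=
    fun {i j p q} hij h => (X_prime.dvd_or_dvd ⟨q, h⟩).resolve_left fun h' =>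
      hij (X_dvd_X.mp h').symm
  -- Shifting `(a₀, b₀)` by `β` times the Koszul relation makes both entries divisible by `x₀`.
  obtain ⟨p, hp⟩ := X_dvd (i := 0) (j := 1) (p := a 0 - B * β) (q := a 1 + B * α) (by decide)
    (by linear_combination h01 - B * hαβ)
  obtain ⟨q, hq⟩ := X_dvd (i := 0) (j := 1) (p := b 0 + A * β) (q := b 1 - A * α) (by decide)
    (by linear_combination k01 + A * hαβ)
  refine ⟨p, q, mul_left_cancel₀ (X_ne_zero (0 : Fin 3)) ?_⟩
  linear_combination hab 0 - A * hp - B * hq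

theorem X_dvd_iff_forall_support {σ K : Type*} [CommSemiring K] {i : σ} {p : MvPolynomial σ K} :
    X i ∣ p ↔ ∀ m ∈ p.support, m i ≠ 0 := by
  rw [← Ideal.mem_span_singleton, ← Set.image_singleton, mem_ideal_span_X_image]
  simp

theorem not_X_dvd_of_mem_supported {σ K : Type*} [CommRing K] {s : Set σ} {i : σ} (hi : i ∉ s)
    {p : MvPolynomial σ K} (hp : p ∈ supported K s) (h0 : p ≠ 0) : ¬ X i ∣ p := by
  intro h
  obtain ⟨m, hm⟩ := support_nonempty.mpr h0
  have hmi := X_dvd_iff_forall_support.mp h m hm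
  exact hi (mem_supported.mp hp ((mem_vars_iff_mem_support i).mpr
    ⟨m, hm, Finsupp.mem_support_iff.mpr hmi⟩))

theorem IsHomogeneous.of_mul_X {σ K : Type*} [CommSemiring K] {i : σ} {p : MvPolynomial σ K}
    {n : ℕ} (h : (p * X i).IsHomogeneous (n + 1)) : p.IsHomogeneous n := by
  intro m hm
  have h1 : coeff (m + Finsupp.single i 1) (p * X i) ≠ 0 := by rwa [coeff_mul_X]
  have h2 := h h1
  rw [map_add, Finsupp.weight_single] at h2
  simpa using h2

end MvPolynomial

namespace PlaneCurve

/-! ### Graded parts, saturation and the Jacobian ideal -/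

theorem gradedPart_of_eq {s : ℤ} {n : ℕ} (h : s = n) :
    gradedPart s = homogeneousSubmodule (Fin 3) ℂ n := by
  subst h
  simp [gradedPart]

theorem mem_gradedPart {s : ℤ} {n : ℕ} (h : s = n) {p : R} :
    p ∈ gradedPart s ↔ p.IsHomogeneous n := by
  rw [gradedPart_of_eq h, mem_homogeneousSubmodule]

theorem X_mem_irrelevantIdeal (i : Fin 3) : (X i : R) ∈ irrelevantIdeal :=
  Ideal.subset_span ⟨i, rfl⟩

theorem mem_irrelevantIdeal_of_isHomogeneous {p : R} {n : ℕ} (hp : p.IsHomogeneous n)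
    (hn : n ≠ 0) : p ∈ irrelevantIdeal := by
  rw [← pow_one irrelevantIdeal, mem_pow_idealOfVars_iff]
  intro m hm
  have := hp (mem_support_iff.mp hm)
  have h1 : m.degree = n := by rw [← this, Finsupp.degree_eq_weight_one]; rfl
  omega

theorem le_saturation (I : Ideal R) : I ≤ saturation I :=
  fun _ hx => ⟨0, fun p _ => I.mul_mem_left p hx⟩

theorem saturation_eq_self {I : Ideal R}
    (h : ∀ u : R, (∀ i : Fin 3, X i * u ∈ I) → u ∈ I) : saturation I = I := by
  refine le_antisymm ?_ (le_saturation I)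
  have key : ∀ k u, (∀ p ∈ irrelevantIdeal ^ k, p * u ∈ I) → u ∈ I := by
    intro k
    induction k with
    | zero => exact fun u hk => by simpa using hk 1 (by simp)
    | succ k ih =>
      refine fun u hk => h u fun i => ih _ fun p hp => ?_
      rw [← mul_assoc]
      refine hk _ ?_
      rw [pow_succ]
      exact Ideal.mul_mem_mul hp (X_mem_irrelevantIdeal i)
  exact fun u ⟨k, hk⟩ => key k u hk

theorem mem_syz {f : R} {v : Fin 3 → R} :
    v ∈ syz f ↔ v 0 * pderiv 0 f + v 1 * pderiv 1 f + v 2 * pderiv 2 f = 0 := by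
  simp [syz, Fintype.linearCombination_apply, Fin.sum_univ_three, grad]

theorem jacobianIdeal_eq (f : R) :
    jacobianIdeal f = Ideal.span {pderiv 0 f, pderiv 1 f, pderiv 2 f} := by
  rw [jacobianIdeal]
  congr 1
  ext x
  simp [grad, Fin.exists_fin_succ, eq_comm]

theorem mem_jacobianIdeal {f u : R} : u ∈ jacobianIdeal f ↔
    ∃ p q r, u = p * pderiv 0 f + q * pderiv 1 f + r * pderiv 2 f := by
  rw [jacobianIdeal_eq, Ideal.mem_span_insert]
  simp only [Ideal.mem_span_pair]
  constructor
  · rintro ⟨p, _, ⟨q, r, rfl⟩, rfl⟩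
    exact ⟨p, q, r, by ring⟩
  · rintro ⟨p, q, r, rfl⟩
    exact ⟨p, _, ⟨q, r, rfl⟩, by ring⟩

/-! ### Consequences of the diagonal syzygy -/

variable {f : R} {d : ℕ} {b c : ℂ}

theorem smul_add_smul_eq_zero_of_mem_support (hsyz : ![0, C b * X 1, C c * X 2] ∈ syz f)
    {m : Fin 3 →₀ ℕ} (hm : m ∈ f.support) : b * m 1 + c * m 2 = 0 := by
  have h := congrArg (coeff m) (mem_syz.mp hsyz)
  simp only [Matrix.cons_val_zero, Matrix.cons_val_one, Matrix.cons_val, zero_mul, zero_add,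
    mul_assoc, coeff_add, coeff_C_mul, coeff_X_mul_pderiv, coeff_zero] at h
  refine (mul_eq_zero.mp ?_).resolve_right (mem_support_iff.mp hm)
  linear_combination h

theorem smul_add_smul_eq_zero_of_mem_support_pderiv_zero
    (hsyz : ![0, C b * X 1, C c * X 2] ∈ syz f) {m : Fin 3 →₀ ℕ}
    (hm : m ∈ (pderiv 0 f).support) : b * m 1 + c * m 2 = 0 := by
  rw [mem_support_iff, coeff_pderiv] at hm
  simpa using smul_add_smul_eq_zero_of_mem_support hsyz
    (mem_support_iff.mpr (left_ne_zero_of_mul hm))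

theorem exists_pderiv_eq (hb : b ≠ 0) (hc : c ≠ 0) (hsyz : ![0, C b * X 1, C c * X 2] ∈ syz f) :
    ∃ h : R, pderiv 1 f = X 2 * h ∧ pderiv 2 f = -(C (b / c) * X 1 * h) := by
  have h := mem_syz.mp hsyz
  simp only [Matrix.cons_val_zero, Matrix.cons_val_one, Matrix.cons_val, zero_mul, zero_add] at h
  have hbb : (C b⁻¹ * C b : R) = 1 := by rw [← C_mul, inv_mul_cancel₀ hb, C_1]
  have hcc : (C c⁻¹ * C c : R) = 1 := by rw [← C_mul, inv_mul_cancel₀ hc, C_1]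
  have h1 : X 1 * pderiv 1 f = X 2 * (-(C b⁻¹ * C c * pderiv 2 f)) := by
    linear_combination C b⁻¹ * h - X 1 * pderiv 1 f * hbb
  obtain ⟨k, hk⟩ := (X_prime.dvd_or_dvd (Dvd.intro _ h1.symm)).resolve_left
    fun h' => absurd (X_dvd_X.mp h') (by decide)
  refine ⟨k, hk, mul_left_cancel₀ (X_ne_zero (2 : Fin 3)) ?_⟩
  rw [div_eq_mul_inv, C_mul]
  linear_combination C c⁻¹ * h - X 2 * pderiv 2 f * hcc - C c⁻¹ * C b * X 1 * hk

/-- A common prime factor would divide all three partial derivatives, hence be a multiple factor of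
`f`. -/
theorem isRelPrime_of_pderiv_eq (hf : f.IsHomogeneous d) (hd : d ≠ 0) (hred : Squarefree f)
    {h p : R} (h1 : pderiv 1 f = X 2 * h) (h2 : pderiv 2 f = p * h) :
    IsRelPrime h (pderiv 0 f) := by
  have key : ∀ q : R, Irreducible q → q ∣ h → ¬ q ∣ pderiv 0 f := by
    intro q hq hqh hq0
    refine hq.not_isUnit (hred q (sq_dvd_of_dvd_pderiv hf hd hq fun i => ?_))
    fin_cases i
    · exact hq0
    · exact h1 ▸ hqh.mul_left _
    · exact h2 ▸ hqh.mul_left _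
  refine WfDvdMonoid.isRelPrime_of_no_irreducible_factors ?_ key
  rintro ⟨rfl, h0⟩
  -- If both vanish, any prime is a common factor; `x₀` serves.
  exact key (X 0) X_prime.irreducible (dvd_zero _) (h0 ▸ dvd_zero _)

/-! ### Consequences of near freeness -/

theorem two_le_of_nearlyFree (hf : f.IsHomogeneous d) (hnf : NearlyFree f) : 2 ≤ d := by
  by_contra! hd
  apply hnf.1
  have hconst : ∀ i, ∃ a, pderiv i f = C a := fun i => by
    have h : (pderiv i f).IsHomogeneous 0 := by
      have := hf.pderiv (i := i)
      rwa [show d - 1 = 0 by omega] at this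
    exact ⟨_, totalDegree_eq_zero_iff_eq_C.mp (Nat.le_zero.mp h.totalDegree_le)⟩
  -- Constant partial derivatives generate the zero or the unit ideal, and both are saturated.
  by_cases hz : ∀ i, pderiv i f = 0
  · have hJ : jacobianIdeal f = ⊥ := by
      rw [jacobianIdeal_eq, hz, hz, hz]
      simp
    rw [hJ]
    refine saturation_eq_self fun u hu => ?_
    simpa using hu 0
  · push Not at hz
    obtain ⟨i, hi⟩ := hz
    obtain ⟨a, ha⟩ := hconst i
    have hJ : jacobianIdeal f = ⊤ := by
      refine Ideal.eq_top_of_isUnit_mem _ (Ideal.subset_span ⟨i, rfl⟩) ?_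
      rw [grad, ha]
      refine IsUnit.map C (isUnit_iff_ne_zero.mpr ?_)
      rintro rfl
      exact hi (ha.trans C_0)
    rw [hJ]
    exact top_le_iff.mp (le_saturation _)

/-- Without `x₀ ^ d`, every monomial of `f₀` involves both `x₁` and `x₂`. If `𝔪 u ⊆ J_f`, then `u =
p h + s f₀`, because the complete intersection `(h, f₀)` is saturated. For `h ≠ 0`, cancelling `h`
in `x₀ u ∈ J_f` gives `x₀ p ∈ (x₁, x₂)`, so `p ∈ (x₁, x₂)` and `u ∈ J_f`. -/
theorem coeff_single_zero_ne_zero (hf : f.IsHomogeneous d) (hd : d ≠ 0) (hred : Squarefree f)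
    (hnf : NearlyFree f) (hb : b ≠ 0) (hc : c ≠ 0)
    (hsyz : ![0, C b * X 1, C c * X 2] ∈ syz f) : coeff (Finsupp.single 0 d) f ≠ 0 := by
  intro hα
  apply hnf.1
  obtain ⟨h, h1, h2⟩ := exists_pderiv_eq hb hc hsyz
  have hrel := isRelPrime_of_pderiv_eq hf hd hred h1 (p := -(C (b / c) * X 1)) (by rw [h2]; ring)
  have hsupp : ∀ m ∈ (pderiv 0 f).support, m 1 ≠ 0 ∧ m 2 ≠ 0 := by
    intro m hm
    have hbc := smul_add_smul_eq_zero_of_mem_support_pderiv_zero hsyz hm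
    have hnot : ¬ (m 1 = 0 ∧ m 2 = 0) := by
      rintro ⟨hm1, hm2⟩
      rw [mem_support_iff, coeff_pderiv] at hm
      have hm' := left_ne_zero_of_mul hm
      have hdeg := hf hm'
      have hms : m + Finsupp.single 0 1 = Finsupp.single 0 (m 0 + 1) := by
        ext i
        fin_cases i <;> simp [hm1, hm2]
      rw [hms] at hm' hdeg
      rw [Finsupp.weight_single] at hdeg
      simp only [Pi.one_apply, smul_eq_mul, mul_one] at hdeg
      rw [hdeg] at hm'
      exact hm' hα
    constructor
    · intro hm1
      refine hnot ⟨hm1, ?_⟩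
      simpa [hm1, hc] using hbc
    · intro hm2
      refine hnot ⟨?_, hm2⟩
      simpa [hm2, hb] using hbc
  obtain ⟨q, hq⟩ : X 1 ∣ pderiv 0 f := X_dvd_iff_forall_support.mpr fun m hm => (hsupp m hm).1
  have h2q : X 2 ∣ X 1 * q := hq ▸ X_dvd_iff_forall_support.mpr fun m hm => (hsupp m hm).2
  obtain ⟨k, rfl⟩ := (X_prime.dvd_or_dvd h2q).resolve_left
    fun h' => absurd (X_dvd_X.mp h') (by decide)
  have hbc : (C (c / b) * C (b / c) : R) = 1 := by
    rw [← C_mul, div_mul_div_cancel₀ hb, div_self hc, C_1]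
  refine saturation_eq_self fun u hu => ?_
  obtain ⟨p, s, rfl⟩ := Ideal.mem_span_pair.mp (mem_span_pair_of_X_mul_mem hrel (u := u) (by
    intro i
    obtain ⟨p, q, r, hpqr⟩ := mem_jacobianIdeal.mp (hu i)
    rw [Ideal.mem_span_pair]
    exact ⟨q * X 2 - r * C (b / c) * X 1, p, by rw [hpqr, h1, h2]; ring⟩))
  obtain ⟨p', q', r', hpqr⟩ := mem_jacobianIdeal.mp (hu 0)
  -- Compare the two expressions of `x₀ u` modulo `h`.
  have hdvd : h ∣ pderiv 0 f * (X 0 * s - p') :=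
    ⟨q' * X 2 - r' * C (b / c) * X 1 - X 0 * p, by rw [h1, h2] at hpqr; linear_combination hpqr⟩
  obtain ⟨t, ht⟩ := hrel.dvd_of_dvd_mul_left hdvd
  by_cases hh : h = 0
  · subst hh
    exact mem_jacobianIdeal.mpr ⟨s, 0, 0, by ring⟩
  have hp : X 0 * p ∈ Ideal.span {X 1, X 2} := by
    refine Ideal.mem_span_pair.mpr ⟨-r' * C (b / c) - t * X 2 * k, q', mul_left_cancel₀ hh ?_⟩
    rw [h1, h2] at hpqr
    linear_combination -hpqr + pderiv 0 f * ht + h * t * hq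
  obtain ⟨x, y, hxy⟩ := Ideal.mem_span_pair.mp
    (((isPrime_span_X_pair 1 2).mem_or_mem hp).resolve_left
      (X_notMem_span_X_pair (by decide) (by decide)))
  refine mem_jacobianIdeal.mpr ⟨s, y, -x * C (c / b), ?_⟩
  rw [h1, h2]
  linear_combination -h * hxy - x * X 1 * h * hbc

/-! ### The decomposition of `∂₀f` and the resolution -/

theorem exists_isDecomposition (hf : f.IsHomogeneous d) (hd : 2 ≤ d)
    (hα : coeff (Finsupp.single 0 d) f ≠ 0) (hc : c ≠ 0)
    (hsyz : ![0, C b * X 1, C c * X 2] ∈ syz f) :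
    ∃ g ω : R, IsDecomposition f d g ω ∧ ω ≠ 0 := by
  obtain ⟨n, rfl⟩ : ∃ n, d = n + 2 := ⟨d - 2, by omega⟩
  set a := coeff (Finsupp.single 0 (n + 1)) (pderiv 0 f) with ha
  have ha0 : a ≠ 0 := by
    rw [ha, coeff_pderiv, ← Finsupp.single_add]
    exact mul_ne_zero hα (Nat.cast_add_one_ne_zero _)
  have hf0 : (pderiv 0 f).IsHomogeneous (n + 1) := hf.pderiv
  have hω : (C a * X 0 ^ (n + 1) : R).IsHomogeneous (n + 1) := by
    simpa using (isHomogeneous_C (Fin 3) a).mul ((isHomogeneous_X ℂ (0 : Fin 3)).pow (n + 1))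
  -- A monomial of `f₀` free of `x₁` is also free of `x₂`, so it is a power of `x₀`.
  have hdvd : (X 1 : R) ∣ pderiv 0 f - C a * X 0 ^ (n + 1) := by
    rw [X_dvd_iff_forall_support]
    intro m hm hm1
    rw [mem_support_iff, coeff_sub, coeff_C_mul, coeff_X_pow] at hm
    split_ifs at hm with hms
    · exact hm (by rw [← hms, ← ha]; ring)
    · rw [mul_zero, sub_zero] at hm
      have hbc := smul_add_smul_eq_zero_of_mem_support_pderiv_zero hsyz (mem_support_iff.mpr hm)
      have hm2 : m 2 = 0 := by simpa [hm1, hc] using hbc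
      have hdeg := hf0 hm
      have hm' : m = Finsupp.single 0 (m 0) := by
        ext i
        fin_cases i <;> simp [hm1, hm2]
      rw [hm', Finsupp.weight_single] at hdeg
      simp only [Pi.one_apply, smul_eq_mul, mul_one] at hdeg
      exact hms (by rw [hm', hdeg])
  obtain ⟨g, hg⟩ := hdvd
  refine ⟨g, C a * X 0 ^ (n + 1), ⟨?_, ?_, ?_, by linear_combination hg⟩, ?_⟩
  · rw [mem_gradedPart (n := n) (by push_cast; ring)]
    refine IsHomogeneous.of_mul_X (i := 1) ?_
    rw [mul_comm, ← hg]
    exact hf0.sub hω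
  · rw [mem_gradedPart (n := n + 1) (by push_cast; ring)]
    exact hω
  · exact mul_mem (Subalgebra.algebraMap_mem _ a)
      (pow_mem (X_mem_supported.mpr (Set.mem_singleton _)) _)
  · exact mul_ne_zero (by simpa using ha0) (pow_ne_zero _ (X_ne_zero _))

theorem pderiv_zero_notMem_span_X_pair (hd : d ≠ 0) (hα : coeff (Finsupp.single 0 d) f ≠ 0) :
    pderiv 0 f ∉ Ideal.span {X 1, X 2} := by
  obtain ⟨n, rfl⟩ : ∃ n, d = n + 1 := ⟨d - 1, by omega⟩
  intro h
  rw [← Set.image_pair, mem_ideal_span_X_image] at h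
  obtain ⟨i, hi, hne⟩ := h (Finsupp.single 0 n) (by
    rw [mem_support_iff, coeff_pderiv, ← Finsupp.single_add]
    exact mul_ne_zero hα (Nat.cast_add_one_ne_zero _))
  rcases hi with rfl | rfl <;> simp at hne

theorem firstSyzygyMatrix_mulVec (g ω : R) (v : Fin 3 → R) :
    (firstSyzygyMatrix f b c g ω).mulVec v =
      ![-(pderiv 1 f * v 1) - pderiv 2 f * v 2, C b * X 1 * v 0 + ω * v 1,
        C c * X 2 * v 0 - C (c / b) * g * X 2 * v 1 + pderiv 0 f * v 2] := by
  ext1 i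
  fin_cases i <;> simp [firstSyzygyMatrix, Matrix.mulVec, dotProduct, Fin.sum_univ_three] <;> ring

theorem secondSyzygyMatrix_mulVec (ω : R) (v : Fin 1 → R) :
    (secondSyzygyMatrix b c ω).mulVec v =
      ![ω * v 0, -(C b * X 1) * v 0, -(C c * X 2) * v 0] := by
  ext1 i
  fin_cases i <;> simp [secondSyzygyMatrix, Matrix.mulVec, dotProduct]

/-- If `∂₀f ∉ (x₁, x₂)`, every Jacobian syzygy is a combination of the columns of the first syzygy
matrix. -/
theorem exists_of_mem_syz (hf : f.IsHomogeneous d) (hd : d ≠ 0) (hred : Squarefree f)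
    (hf0 : pderiv 0 f ∉ Ideal.span {X 1, X 2}) {g ω h : R} (hh : h ≠ 0) (hb : b ≠ 0) (hc : c ≠ 0)
    (h1 : pderiv 1 f = X 2 * h) (h2 : pderiv 2 f = -(C (b / c) * X 1 * h))
    (hg : pderiv 0 f = g * X 1 + ω) {v : Fin 3 → R} (hv : v ∈ syz f) :
    ∃ w, (firstSyzygyMatrix f b c g ω).mulVec w = v := by
  have hbc : (C (c / b) * C (b / c) : R) = 1 := by
    rw [← C_mul, div_mul_div_cancel₀ hb, div_self hc, C_1]
  have hbb : (C b * C b⁻¹ : R) = 1 := by rw [← C_mul, mul_inv_cancel₀ hb, C_1]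
  have hcb : (C c * C b⁻¹ : R) = C (c / b) := by rw [← C_mul, div_eq_mul_inv]
  rw [mem_syz, h1, h2] at hv
  have hrel := isRelPrime_of_pderiv_eq hf hd hred h1 (p := -(C (b / c) * X 1)) (by rw [h2]; ring)
  obtain ⟨e, he⟩ := hrel.dvd_of_dvd_mul_left (z := v 0)
    ⟨-(v 1 * X 2) + v 2 * C (b / c) * X 1, by linear_combination hv⟩
  have hrow : pderiv 0 f * e = -(v 1 * X 2) + v 2 * C (b / c) * X 1 := by
    apply mul_left_cancel₀ hh
    linear_combination hv - pderiv 0 f * he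
  have hmem : pderiv 0 f * e ∈ Ideal.span {X 1, X 2} :=
    Ideal.mem_span_pair.mpr ⟨v 2 * C (b / c), -v 1, by rw [hrow]; ring⟩
  obtain ⟨x, y, hxy⟩ := Ideal.mem_span_pair.mp
    (((isPrime_span_X_pair 1 2).mem_or_mem hmem).resolve_left hf0)
  have hdvd : X 1 * (v 2 * C (b / c) - pderiv 0 f * x) = X 2 * (v 1 + pderiv 0 f * y) := by
    linear_combination -hrow - pderiv 0 f * hxy
  obtain ⟨z, hz⟩ := (X_prime.dvd_or_dvd (Dvd.intro _ hdvd)).resolve_left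
    fun h' => absurd (X_dvd_X.mp h') (by decide)
  have hz2 : v 2 * C (b / c) - pderiv 0 f * x = X 2 * z := by
    apply mul_left_cancel₀ (X_ne_zero (1 : Fin 3))
    linear_combination hdvd + X 2 * hz
  -- The coefficients `-y` and `(c/b) x` reproduce `v₀ = h (x x₁ + y x₂)`. The first column does not
  -- affect `v₀`, and its coefficient is read off from `v₁ = x₁ z - f₀ y`.
  refine ⟨![C b⁻¹ * (z - g * y), -y, C (c / b) * x], ?_⟩
  rw [firstSyzygyMatrix_mulVec]
  ext1 i
  fin_cases i
  · simp [h1, h2]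
    linear_combination -he + h * hxy + X 1 * h * x * hbc
  · simp
    linear_combination X 1 * (z - g * y) * hbb - hz + y * hg
  · simp
    linear_combination X 2 * (z - g * y) * hcb - C (c / b) * hz2 + v 2 * hbc

/-- In a constant syzygy, `v₀ f₀ ∈ (x₁, x₂)` forces `v₀ = 0`; then `x₂ v₁` is a multiple of `x₁`,
which forces `v₁ = v₂ = 0`. The given syzygy has degree one, so the infimum is not the default value
of `sInf ∅`. -/
theorem mdr_eq_one {h : R} (hh : h ≠ 0) (hb : b ≠ 0) (hc : c ≠ 0)
    (hsyz : ![0, C b * X 1, C c * X 2] ∈ syz f)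
    (hf0 : pderiv 0 f ∉ Ideal.span {X 1, X 2}) (h1 : pderiv 1 f = X 2 * h)
    (h2 : pderiv 2 f = -(C (b / c) * X 1 * h)) : mdr f = 1 := by
  have hmem : ∃ v ∈ syz f, v ≠ 0 ∧ ∀ i, (v i).IsHomogeneous 1 := by
    refine ⟨_, hsyz, fun h0 => ?_, fun i => ?_⟩
    · exact mul_ne_zero (a := (C b : R)) (by simpa using hb) (X_ne_zero (1 : Fin 3))
        (by simpa using congrFun h0 1)
    · fin_cases i
      · exact isHomogeneous_zero _ _ _
      · exact isHomogeneous_C_mul_X _ _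
      · exact isHomogeneous_C_mul_X _ _
  refine le_antisymm (Nat.sInf_le hmem) (le_csInf ⟨1, hmem⟩ ?_)
  rintro n ⟨v, hv, hv0, hdeg⟩
  rw [Nat.one_le_iff_ne_zero]
  rintro rfl
  apply hv0
  have hzero : ∀ i, constantCoeff (v i) = 0 → v i = 0 := by
    intro i hi
    rw [totalDegree_eq_zero_iff_eq_C.mp (Nat.le_zero.mp (hdeg i).totalDegree_le),
      ← constantCoeff_eq, hi, C_0]
  rw [mem_syz, h1, h2] at hv
  have hv0f : v 0 * pderiv 0 f ∈ Ideal.span {X 1, X 2} :=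
    Ideal.mem_span_pair.mpr ⟨v 2 * C (b / c) * h, -v 1 * h, by linear_combination -hv⟩
  obtain ⟨x, y, hxy⟩ := Ideal.mem_span_pair.mp
    (((isPrime_span_X_pair 1 2).mem_or_mem hv0f).resolve_right hf0)
  have hz0 : v 0 = 0 := hzero 0 (by rw [← hxy]; simp)
  have hz12 : X 2 * v 1 = X 1 * (C (b / c) * v 2) := by
    apply mul_left_cancel₀ hh
    rw [hz0] at hv
    linear_combination hv
  obtain ⟨z, hz⟩ := (X_prime.dvd_or_dvd (Dvd.intro _ hz12.symm)).resolve_left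
    fun h' => absurd (X_dvd_X.mp h') (by decide)
  have hz1 : v 1 = 0 := hzero 1 (by rw [hz]; simp)
  have hz2 : v 2 = 0 := by
    rw [hz1, mul_zero, eq_comm, mul_eq_zero, mul_eq_zero] at hz12
    refine (hz12.resolve_left (X_ne_zero _)).resolve_left ?_
    simpa using ⟨hb, hc⟩
  ext1 i
  fin_cases i
  · exact hz0
  · exact hz1
  · exact hz2

theorem areSyzygyMatrices (hf : f.IsHomogeneous d) (hd : 2 ≤ d) (hred : Squarefree f)
    (hf0 : pderiv 0 f ∉ Ideal.span {X 1, X 2}) {g ω h : R} (hh : h ≠ 0) (hb : b ≠ 0) (hc : c ≠ 0)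
    (h1 : pderiv 1 f = X 2 * h) (h2 : pderiv 2 f = -(C (b / c) * X 1 * h))
    (hg : IsDecomposition f d g ω) :
    AreSyzygyMatrices f d 1 (firstSyzygyMatrix f b c g ω) (secondSyzygyMatrix b c ω) := by
  obtain ⟨n, rfl⟩ : ∃ n, d = n + 2 := ⟨d - 2, by omega⟩
  obtain ⟨hgd, hωd, hωs, hdec⟩ := hg
  rw [mem_gradedPart (n := n) (by push_cast; ring)] at hgd
  rw [mem_gradedPart (n := n + 1) (by push_cast; ring)] at hωd
  have hpd : ∀ i, (pderiv i f).IsHomogeneous (n + 1) := fun i => hf.pderiv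
  have hgX : (C (c / b) * g * X 2).IsHomogeneous (n + 1) := by
    simpa using ((isHomogeneous_C (Fin 3) (c / b)).mul hgd).mul (isHomogeneous_X ℂ (2 : Fin 3))
  have hX : ∀ (a : ℂ) (i : Fin 3), (C a * X i : R).IsHomogeneous 1 :=
    fun a i => isHomogeneous_C_mul_X _ _
  have hf00 : pderiv 0 f ≠ 0 := fun h0 => hf0 (h0 ▸ Ideal.zero_mem _)
  have hω0 : ω ≠ 0 := by
    rintro rfl
    exact hf0 (Ideal.mem_span_pair.mpr ⟨g, 0, by rw [hdec]; ring⟩)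
  have hωX : ¬ X 1 ∣ ω := not_X_dvd_of_mem_supported (by simp) hωs hω0
  have hCb : (C b : R) ≠ 0 := by simpa using hb
  have hbb : (C b * C b⁻¹ : R) = 1 := by rw [← C_mul, mul_inv_cancel₀ hb, C_1]
  have hcb : (C (c / b) * C b : R) = C c := by rw [← C_mul, div_mul_cancel₀ c hb]
  have hbc : (C (b / c) * C c : R) = C b := by rw [← C_mul, div_mul_cancel₀ b hc]
  have hb1c : (C (c / b) * C (b / c) : R) = 1 := by
    rw [← C_mul, div_mul_div_cancel₀ hb, div_self hc, C_1]
  have hM : ∀ i j, firstSyzygyMatrix f b c g ω i j ∈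
      homogeneousSubmodule (Fin 3) ℂ (![1, n + 1, n + 1] j) := by
    intro i j
    fin_cases i <;> fin_cases j
    · exact isHomogeneous_zero _ _ _
    · exact (hpd 1).neg
    · exact (hpd 2).neg
    · exact hX b 1
    · exact hωd
    · exact isHomogeneous_zero _ _ _
    · exact hX c 2
    · exact hgX.neg
    · exact hpd 0
  have hP : ∀ i j, secondSyzygyMatrix b c ω i j ∈
      homogeneousSubmodule (Fin 3) ℂ (![n + 1, 1, 1] i) := by
    intro i j
    fin_cases i <;> fin_cases j
    · exact hωd
    · exact (hX b 1).neg
    · exact (hX c 2).neg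
  refine ⟨fun i => ?_, fun i j => ?_, fun j k => ?_, ?_, ?_, ?_, ?_, fun i j => ?_, fun j k => ?_⟩
  · rw [mem_gradedPart (n := n + 1) (by fin_cases i <;> simp <;> ring)]
    exact hpd i
  · rw [gradedPart_of_eq (n := ![1, n + 1, n + 1] j) (by
      fin_cases i <;> fin_cases j <;> simp <;> ring)]
    exact hM i j
  · rw [gradedPart_of_eq (n := ![n + 1, 1, 1] j) (by fin_cases j <;> simp <;> ring)]
    exact hP j k
  · rw [Fintype.range_linearCombination]
    rfl
  · intro v
    constructor
    · exact fun hv => exists_of_mem_syz hf (by omega) hred hf0 hh hb hc h1 h2 hdec hv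
    · rintro ⟨w, rfl⟩
      change _ ∈ syz f
      rw [Matrix.mulVecLin_apply, firstSyzygyMatrix_mulVec, mem_syz]
      simp only [Matrix.cons_val_zero, Matrix.cons_val_one, Matrix.cons_val]
      rw [h1, h2, hdec]
      linear_combination w 0 * X 1 * X 2 * h * -hbc + w 1 * g * X 1 * X 2 * h * hb1c
  · intro v
    rw [Matrix.mulVecLin_apply, firstSyzygyMatrix_mulVec]
    constructor
    · intro hv
      have e1 : C b * X 1 * v 0 + ω * v 1 = 0 := congrFun hv 1
      have e2 : C c * X 2 * v 0 - C (c / b) * g * X 2 * v 1 + pderiv 0 f * v 2 = 0 := congrFun hv 2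
      -- The last two rows determine the kernel: the second gives `x₁ ∣ v₁` and then `v₀`, the third
      -- gives `v₂` after cancelling `f₀`.
      obtain ⟨z, hz⟩ := (X_prime.dvd_or_dvd (p := X 1) (a := ω) (b := v 1)
        ⟨-(C b * v 0), by linear_combination e1⟩).resolve_left hωX
      have e0 : v 0 = ω * -(C b⁻¹ * z) := by
        apply mul_left_cancel₀ hCb
        apply mul_left_cancel₀ (X_ne_zero (1 : Fin 3))
        linear_combination e1 - ω * hz + ω * X 1 * z * hbb
      refine ⟨fun _ => -(C b⁻¹ * z), ?_⟩
      rw [Matrix.mulVecLin_apply, secondSyzygyMatrix_mulVec]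
      have e3 : v 2 = C c * X 2 * (C b⁻¹ * z) := by
        apply mul_left_cancel₀ hf00
        have hcb' : (C (c / b) : R) = C c * C b⁻¹ := by rw [← C_mul, div_eq_mul_inv]
        rw [hcb', hz, e0] at e2
        linear_combination e2 - C c * X 2 * C b⁻¹ * z * hdec
      ext1 i
      fin_cases i
      · exact e0.symm
      · change -(C b * X 1) * -(C b⁻¹ * z) = v 1
        rw [hz]
        linear_combination X 1 * z * hbb
      · change -(C c * X 2) * -(C b⁻¹ * z) = v 2
        rw [e3]
        ring
    · rintro ⟨w, rfl⟩
      rw [Matrix.mulVecLin_apply, secondSyzygyMatrix_mulVec]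
      ext1 i
      fin_cases i
      · simp only [Fin.zero_eta, Matrix.cons_val_zero, Matrix.cons_val_one, Matrix.cons_val,
          Pi.zero_apply]
        rw [h1, h2]
        linear_combination -X 1 * X 2 * h * w 0 * hbc
      · simp only [Fin.mk_one, Matrix.cons_val_zero, Matrix.cons_val_one, Matrix.cons_val,
          Pi.zero_apply]
        ring
      · simp only [Fin.reduceFinMk, Matrix.cons_val_zero, Matrix.cons_val_one, Matrix.cons_val,
          Pi.zero_apply]
        rw [hdec]
        linear_combination g * X 1 * X 2 * w 0 * hcb
  · rw [← LinearMap.ker_eq_bot, LinearMap.ker_eq_bot']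
    intro w hw
    rw [Matrix.mulVecLin_apply, secondSyzygyMatrix_mulVec] at hw
    ext1 i
    rw [Subsingleton.elim i 0]
    exact (mul_eq_zero.mp (congrFun hw 0)).resolve_left hω0
  · exact mem_irrelevantIdeal_of_isHomogeneous (hM i j) (by fin_cases j <;> simp)
  · exact mem_irrelevantIdeal_of_isHomogeneous (hP j k) (by fin_cases j <;> simp)

end PlaneCurve

theorem proposition5 (d : ℕ) (f : PlaneCurve.R) (hf : f.IsHomogeneous d) (hred : Squarefree f)
    (hnf : PlaneCurve.NearlyFree f) (b c : ℂ) (hb : b ≠ 0) (hc : c ≠ 0)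
    (hsyz : ![0, C b * X 1, C c * X 2] ∈ PlaneCurve.syz f) :
    PlaneCurve.mdr f = 1 ∧ 2 * PlaneCurve.mdr f ≤ d ∧
    (∃ g ω : PlaneCurve.R, PlaneCurve.IsDecomposition f d g ω ∧ ω ≠ 0) ∧
    ∀ g ω : PlaneCurve.R, PlaneCurve.IsDecomposition f d g ω →
      PlaneCurve.AreSyzygyMatrices f d (PlaneCurve.mdr f)
        (PlaneCurve.firstSyzygyMatrix f b c g ω) (PlaneCurve.secondSyzygyMatrix b c ω) := by
  have hd := PlaneCurve.two_le_of_nearlyFree hf hnf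
  have hd0 : d ≠ 0 := by omega
  have hα := PlaneCurve.coeff_single_zero_ne_zero hf hd0 hred hnf hb hc hsyz
  have hf0 := PlaneCurve.pderiv_zero_notMem_span_X_pair hd0 hα
  obtain ⟨h, h1, h2⟩ := PlaneCurve.exists_pderiv_eq hb hc hsyz
  -- If `h = 0`, coprimality makes `f₀` a unit, although it is homogeneous of degree `d - 1 ≥ 1`.
  have hh : h ≠ 0 := by
    rintro rfl
    have hrel := PlaneCurve.isRelPrime_of_pderiv_eq hf hd0 hred h1
      (p := -(C (b / c) * X 1)) (by rw [h2]; ring)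
    have hu : IsUnit (pderiv 0 f) := hrel (dvd_zero _) (dvd_refl _)
    have h0 : constantCoeff (pderiv 0 f) = 0 := by
      rw [constantCoeff_eq]
      refine (hf.pderiv (i := 0)).coeff_eq_zero ?_
      rw [map_zero]
      omega
    exact (hu.map constantCoeff).ne_zero h0
  have hmdr := PlaneCurve.mdr_eq_one hh hb hc hsyz hf0 h1 h2
  rw [hmdr]
  exact ⟨rfl, hd, PlaneCurve.exists_isDecomposition hf hd hα hc hsyz, fun g ω hg =>
    PlaneCurve.areSyzygyMatrices hf hd hred hf0 hh hb hc h1 h2 hg⟩
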